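/- Let $K,M,N,Z_x,Z_y$ be positive integers with $Z_x,Z_y\le N$, and write $\omega_N=e^{2\pi\sqrt{-1}/N}$. Let $\mathcal C=\{\mathbf C^{(0)},\dots,\mathbf C^{(K-1)}\}$ be a unimodular DRCS (Doppler-resilient complementary sequence) set: each $\mathbf C^{(k)}$ consists of $M$ complex sequences $\mathbf c^{(k)}_0,\dots,\mathbf c^{(k)}_{M-1}$ of length $N$ all of whose entries have modulus $1$. For integers $\tau,v$ let $$AF_{\mathbf C^{(k)},\mathbf C^{(l)}}(\tau,v)=\sum_{i=0}^{M-1}\ \sum_{\substack{0\le t\le N-1\\ 0\le t+\tau\le N-1}} c^{(k)}_i(t)\,\overline{c^{(l)}_i(t+\tau)}\,\omega_N^{vt}.$$ Over the integer points $(\tau,v)$ of $\Pi=(-Z_x,Z_x)\times(-Z_y,Z_y)$, let $$\theta_a=\max_{k,\ (\tau,v)\in\Pi\setminus\{(0,0)\}}\bigl|AF_{\mathbf C^{(k)},\mathbf C^{(k)}}(\tau,v)\bigr|,\qquad \theta_c=\max_{k\ne l,\ (\tau,v)\in\Pi}\bigl|AF_{\mathbf C^{(k)},\mathbf C^{(l)}}(\tau,v)\bigr|,$$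 (the maximum of an empty set being $0$), and $\theta_{\max}=\max\{\theta_a,\theta_c\}$. Suppose that $KZ_y\le MN^2$, put $\gamma=\arccos\left(1-\frac{KZ_y}{MN^2}\right)$, and let $m$ be an integer with $1\le m<\min\{Z_x+1,\ \pi/\gamma+1\}$. Then $$\theta_{\max}^2\ \ge\ \frac{(K-1)\theta_c^2+\theta_a^2}{K}\ \ge\ M\left(N-\frac{m-1}{2}-\frac{\sin\frac{m\gamma}{2}-\sin\frac{(m-2)\gamma}{2}}{2(1-\cos\gamma)\sin\frac{m\gamma}{2}}\right).$$ -/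

import Mathlib

namespace DRCS

noncomputable section

/-- The primitive `N`-th root of unity `exp (2 π i / N)`. -/
def omega (N : ℕ) : ℂ := Complex.exp (2 * (Real.pi : ℂ) * Complex.I / (N : ℂ))

/-- Aperiodic cross ambiguity function of two sequences of length `N` at the (integer) time shift
`τ` and Doppler `v`: the sum of `a(s) * conj (b(s + τ)) * ω_N ^ (v s)` over all `s` such that both
`s` and `s + τ` lie in `{0, …, N - 1}`, i.e. `0 ≤ s ≤ N - 1 - τ` if `0 ≤ τ ≤ N - 1`,
`-τ ≤ s ≤ N - 1` if `1 - N ≤ τ < 0`, and no `s` (value `0`) if `|τ| ≥ N`. -/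
def seqAF {N : ℕ} (a b : Fin N → ℂ) (τ v : ℤ) : ℂ :=
  ∑ s : Fin N, ∑ t : Fin N,
    if ((t : ℕ) : ℤ) = ((s : ℕ) : ℤ) + τ then
      a s * (starRingEnd ℂ) (b t) * omega N ^ (v * ((s : ℕ) : ℤ))
    else 0

/-- Aperiodic cross ambiguity function of two families of `M` elementary sequences of length `N`:
the sum of the ambiguity functions of corresponding elementary sequences. -/
def compAF {M N : ℕ} (A B : Fin M → Fin N → ℂ) (τ v : ℤ) : ℂ :=
  ∑ m : Fin M, seqAF (A m) (B m) τ v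

/-- All entries of all sequences have modulus one. -/
def IsUnimodular {K M N : ℕ} (C : Fin K → Fin M → Fin N → ℂ) : Prop :=
  ∀ k m n, ‖C k m n‖ = 1

/-- Membership of the integer point `(τ, v)` in `(-Zx, Zx) × (-Zy, Zy)`. -/
def InZone (Zx Zy : ℕ) (τ v : ℤ) : Prop := |τ| < (Zx : ℤ) ∧ |v| < (Zy : ℤ)

/-- The (finitely many) auto ambiguity magnitudes over the zone, the origin excluded. -/
def autoMagnitudes {K M N : ℕ} (C : Fin K → Fin M → Fin N → ℂ) (Zx Zy : ℕ) : Set ℝ :=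
  {x | ∃ (k : Fin K) (τ v : ℤ), InZone Zx Zy τ v ∧ (τ, v) ≠ (0, 0) ∧
    x = ‖compAF (C k) (C k) τ v‖}

/-- The (finitely many) cross ambiguity magnitudes of two different members over the zone. -/
def crossMagnitudes {K M N : ℕ} (C : Fin K → Fin M → Fin N → ℂ) (Zx Zy : ℕ) : Set ℝ :=
  {x | ∃ (k l : Fin K) (τ v : ℤ), k ≠ l ∧ InZone Zx Zy τ v ∧
    x = ‖compAF (C k) (C l) τ v‖}

/-- Maximum auto ambiguity magnitude (`0` if there is no shift other than the origin). -/
def thetaAuto {K M N : ℕ} (C : Fin K → Fin M → Fin N → ℂ) (Zx Zy : ℕ) : ℝ :=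
  sSup (autoMagnitudes C Zx Zy)

/-- Maximum cross ambiguity magnitude (`0` if there is only one member). -/
def thetaCross {K M N : ℕ} (C : Fin K → Fin M → Fin N → ℂ) (Zx Zy : ℕ) : ℝ :=
  sSup (crossMagnitudes C Zx Zy)

/-- Maximum ambiguity magnitude of the set over the zone. -/
def thetaMax {K M N : ℕ} (C : Fin K → Fin M → Fin N → ℂ) (Zx Zy : ℕ) : ℝ :=
  max (thetaAuto C Zx Zy) (thetaCross C Zx Zy)

end

end DRCS

/-!
The bound is a weighted Levenshtein argument. To every member `k`, delay `s < m` and Doppler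
`v < Zy` attach the vector `delayed` of coordinates `(i, t)`: the member delayed by `s`, padded with
zeros and modulated by `ω ^ (v t)`. Up to a phase the inner product of two of these vectors is a
value of the ambiguity function at a point of the zone (`inner_delayed`). Give the vectors
nonnegative weights `w s` with sum one.

The weighted sum of the squared inner products is the squared Frobenius norm of the weighted frame
matrix `∑ w x x*`, hence at least the contribution of the diagonal of that matrix
(`sum_diag_sq_le_sum_norm_inner_sq`). Unimodularity makes this diagonal explicit, and it contributes
`K² Zy² M ∑ w s w s' (N - |s - s'|)`. On the other side the squared inner products are at most
`θ_a²` or `θ_c²`, apart from the norms `(M N)²` of the vectors with themselves. This gives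
`weighted_bound`:
`((K-1) θ_c² + θ_a²) / K ≥ M (N - ∑ |s - s'| w s w s' - a ∑ (w s)²)` with `a = M N² / (K Zy)`.

It remains to make the quadratic form on the right small. The choice `w s ∝ cos (γ (s - (m-1)/2))`
with `a (1 - cos γ) = 1` solves the stationarity equations: `a w s + ∑ |s - s'| w s'` does not depend
on `s` (`cosWeight_stationary`), so the form equals the value of this expression at `s = 0`. The
condition `m < π/γ + 1` is what makes these weights nonnegative.
-/

namespace DRCS

open Finset

/-! ### Weighted Gram matrices -/

/-- The weighted sum of squared inner products of a finite family of vectors dominates the squared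
diagonal of the weighted frame matrix `∑ w x x*`: both are parts of its squared Frobenius norm. -/
theorem sum_diag_sq_le_sum_norm_inner_sq {ι κ : Type*} [Fintype ι] [Fintype κ]
    (w : ι → ℝ) (x : ι → κ → ℂ) :
    ∑ c, (∑ a, w a * ‖x a c‖ ^ 2) ^ 2 ≤
      ∑ a, ∑ b, w a * w b * ‖∑ c, x a c * (starRingEnd ℂ) (x b c)‖ ^ 2 := by
  have key : ∑ a, ∑ b, w a * w b * ‖∑ c, x a c * (starRingEnd ℂ) (x b c)‖ ^ 2 =
      ∑ c, ∑ d, ‖∑ a, (w a : ℂ) * (x a c * (starRingEnd ℂ) (x a d))‖ ^ 2 := by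
    apply Complex.ofReal_injective
    push_cast
    simp only [← Complex.mul_conj', map_sum, map_mul, Complex.conj_conj, Complex.conj_ofReal,
      Finset.sum_mul_sum]
    simp only [Finset.mul_sum]
    have e1 : ∀ a, ∑ b, ∑ c, ∑ d, (w a : ℂ) * (w b : ℂ) *
          (x a c * (starRingEnd ℂ) (x b c) * ((starRingEnd ℂ) (x a d) * x b d)) =
        ∑ c, ∑ d, ∑ b, (w a : ℂ) * (w b : ℂ) *
          (x a c * (starRingEnd ℂ) (x b c) * ((starRingEnd ℂ) (x a d) * x b d)) := fun a => by
      rw [Finset.sum_comm]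
      exact Finset.sum_congr rfl fun c _ => Finset.sum_comm
    simp only [e1]
    rw [Finset.sum_comm]
    refine Finset.sum_congr rfl fun c _ => ?_
    rw [Finset.sum_comm]
    refine Finset.sum_congr rfl fun d _ => ?_
    refine Finset.sum_congr rfl fun a _ => Finset.sum_congr rfl fun b _ => ?_
    ring
  rw [key]
  refine Finset.sum_le_sum fun c _ => ?_
  refine le_trans (le_of_eq ?_) (Finset.single_le_sum (f := fun d =>
    ‖∑ a, (w a : ℂ) * (x a c * (starRingEnd ℂ) (x a d))‖ ^ 2)
    (fun d _ => by positivity) (Finset.mem_univ c))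
  simp only [Complex.mul_conj']
  rw [← sq_abs, ← Real.norm_eq_abs, ← Complex.norm_real]
  push_cast
  rfl

/-! ### Delayed and modulated sequences -/

theorem omega_ne_zero (N : ℕ) : omega N ≠ 0 := Complex.exp_ne_zero _

theorem norm_omega (N : ℕ) : ‖omega N‖ = 1 := by
  have h : 2 * (Real.pi : ℂ) * Complex.I / (N : ℂ) = ((2 * Real.pi / N : ℝ) : ℂ) * Complex.I := by
    push_cast
    ring
  rw [omega, h, Complex.norm_exp_ofReal_mul_I]

theorem norm_omega_zpow (N : ℕ) (v : ℤ) : ‖omega N ^ v‖ = 1 := by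
  rw [norm_zpow, norm_omega, one_zpow]

/-- The family `A` delayed by `s`, padded with zeros to length `L` and modulated by `ω_N ^ (v t)`.
The sum over `n` has at most one nonzero term, `n = t - s`. -/
noncomputable def delayed {M N : ℕ} (A : Fin M → Fin N → ℂ) (L s v : ℕ) : Fin M × Fin L → ℂ :=
  fun p => ∑ n : Fin N,
    if (n : ℕ) + s = p.2 then A p.1 n * omega N ^ ((v : ℤ) * ((p.2 : ℕ) : ℤ)) else 0

theorem sum_ite_add_eq {N : ℕ} {E : Type*} [AddCommMonoid E] (f : Fin N → E) (s t : ℕ) :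
    (∑ n : Fin N, if (n : ℕ) + s = t then f n else 0) =
      if h : s ≤ t ∧ t < s + N then f ⟨t - s, by omega⟩ else 0 := by
  split_ifs with h
  · rw [Finset.sum_eq_single ⟨t - s, by omega⟩]
    · rw [if_pos (by simp only; omega)]
    · intro n _ hn
      rw [if_neg]
      intro h'
      exact hn (Fin.ext (by simp only; omega))
    · simp
  · refine Finset.sum_eq_zero fun n _ => if_neg ?_
    have := n.2
    omega

theorem norm_sq_delayed {M N : ℕ} {A : Fin M → Fin N → ℂ} (hA : ∀ i n, ‖A i n‖ = 1)
    (L s v : ℕ) (p : Fin M × Fin L) :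
    ‖delayed A L s v p‖ ^ 2 = if s ≤ (p.2 : ℕ) ∧ (p.2 : ℕ) < s + N then 1 else 0 := by
  rw [delayed, sum_ite_add_eq]
  split_ifs with h
  · rw [norm_mul, hA, norm_omega_zpow]
    norm_num
  · simp

/-- Up to a phase, inner products of delayed and modulated families are ambiguity values. -/
theorem inner_delayed {M N : ℕ} (A B : Fin M → Fin N → ℂ) {L s s' : ℕ} (hs : N + s ≤ L)
    (v v' : ℕ) :
    ∑ p, delayed A L s v p * (starRingEnd ℂ) (delayed B L s' v' p) =
      omega N ^ (((v : ℤ) - v') * s) * compAF A B ((s : ℤ) - s') ((v : ℤ) - v') := by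
  have hconj : ∀ z : ℤ, (starRingEnd ℂ) (omega N ^ z) = omega N ^ (-z) := by
    intro z
    rw [zpow_neg, Complex.inv_eq_conj (norm_omega_zpow N z)]
  rw [Fintype.sum_prod_type, compAF, Finset.mul_sum]
  refine Finset.sum_congr rfl fun i _ => ?_
  simp only [delayed, seqAF, map_sum, Finset.sum_mul_sum]
  simp only [Finset.mul_sum]
  rw [Finset.sum_comm]
  refine Finset.sum_congr rfl fun n _ => ?_
  rw [Finset.sum_comm]
  refine Finset.sum_congr rfl fun n' _ => ?_
  have hn := n.2
  -- Only the coordinate `t = n + s` contributes.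
  rw [Finset.sum_eq_single (⟨n + s, by omega⟩ : Fin L)]
  · simp only [if_true]
    by_cases h : (n' : ℕ) + s' = n + s
    · rw [if_pos h, if_pos (by omega), map_mul, hconj]
      have : omega N ^ ((v : ℤ) * ((n + s : ℕ) : ℤ)) * omega N ^ (-((v' : ℤ) * ((n + s : ℕ) : ℤ))) =
          omega N ^ (((v : ℤ) - v') * s) * omega N ^ (((v : ℤ) - v') * ((n : ℕ) : ℤ)) := by
        rw [← zpow_add₀ (omega_ne_zero N), ← zpow_add₀ (omega_ne_zero N)]
        congr 1
        push_cast
        ring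
      linear_combination (A i n * (starRingEnd ℂ) (B i n')) * this
    · rw [if_neg h, if_neg (by omega)]
      simp
  · intro t _ ht
    rw [if_neg, zero_mul]
    intro h
    exact ht (Fin.ext h.symm)
  · simp

/-! ### Ambiguity magnitudes over the zone -/

theorem norm_compAF_le {M N : ℕ} {A B : Fin M → Fin N → ℂ} (hA : ∀ i n, ‖A i n‖ = 1)
    (hB : ∀ i n, ‖B i n‖ = 1) (τ v : ℤ) : ‖compAF A B τ v‖ ≤ M * (N * N) := by
  have h : ∀ i, ‖seqAF (A i) (B i) τ v‖ ≤ N * N := by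
    intro i
    calc ‖seqAF (A i) (B i) τ v‖ ≤ ∑ _s : Fin N, ∑ _t : Fin N, (1 : ℝ) := by
          refine norm_sum_le_of_le _ fun s _ => norm_sum_le_of_le _ fun t _ => ?_
          split_ifs
          · rw [norm_mul, norm_mul, hA, RCLike.norm_conj, hB, norm_omega_zpow]
            norm_num
          · simp
      _ = N * N := by simp
  calc ‖compAF A B τ v‖ ≤ ∑ _i : Fin M, ((N : ℝ) * N) := norm_sum_le_of_le _ fun i _ => h i
    _ = M * (N * N) := by simp

theorem norm_compAF_self_zero {M N : ℕ} {A : Fin M → Fin N → ℂ} (hA : ∀ i n, ‖A i n‖ = 1) :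
    ‖compAF A A 0 0‖ = M * N := by
  have : compAF A A 0 0 = ((M * N : ℝ) : ℂ) := by
    simp only [compAF, seqAF, add_zero, zero_mul, zpow_zero, mul_one, Nat.cast_inj,
      Fin.val_inj, Finset.sum_ite_eq', Finset.mem_univ, if_true, Complex.mul_conj', hA]
    simp
  rw [this, Complex.norm_real, Real.norm_of_nonneg (by positivity)]

section Zone

variable {K M N : ℕ} {C : Fin K → Fin M → Fin N → ℂ}

theorem norm_compAF_le_thetaAuto (hC : IsUnimodular C) {Zx Zy : ℕ} {τ v : ℤ} (k : Fin K)
    (hz : InZone Zx Zy τ v) (h0 : (τ, v) ≠ (0, 0)) :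
    ‖compAF (C k) (C k) τ v‖ ≤ thetaAuto C Zx Zy := by
  refine le_csSup ⟨M * (N * N), ?_⟩ ⟨k, τ, v, hz, h0, rfl⟩
  rintro _ ⟨k, τ, v, _, _, rfl⟩
  exact norm_compAF_le (hC k) (hC k) τ v

theorem norm_compAF_le_thetaCross (hC : IsUnimodular C) {Zx Zy : ℕ} {τ v : ℤ} {k l : Fin K}
    (hkl : k ≠ l) (hz : InZone Zx Zy τ v) :
    ‖compAF (C k) (C l) τ v‖ ≤ thetaCross C Zx Zy := by
  refine le_csSup ⟨M * (N * N), ?_⟩ ⟨k, l, τ, v, hkl, hz, rfl⟩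
  rintro _ ⟨k, l, τ, v, _, _, rfl⟩
  exact norm_compAF_le (hC k) (hC l) τ v

theorem thetaAuto_nonneg (C : Fin K → Fin M → Fin N → ℂ) (Zx Zy : ℕ) : 0 ≤ thetaAuto C Zx Zy := by
  refine Real.sSup_nonneg ?_
  rintro _ ⟨k, τ, v, _, _, rfl⟩
  exact norm_nonneg _

theorem thetaCross_nonneg (C : Fin K → Fin M → Fin N → ℂ) (Zx Zy : ℕ) :
    0 ≤ thetaCross C Zx Zy := by
  refine Real.sSup_nonneg ?_
  rintro _ ⟨k, l, τ, v, _, _, rfl⟩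
  exact norm_nonneg _

theorem average_le_thetaMax_sq (hK : 1 ≤ K) (C : Fin K → Fin M → Fin N → ℂ) (Zx Zy : ℕ) :
    (((K : ℝ) - 1) * thetaCross C Zx Zy ^ 2 + thetaAuto C Zx Zy ^ 2) / K ≤
      thetaMax C Zx Zy ^ 2 := by
  have hK' : (1 : ℝ) ≤ K := by exact_mod_cast hK
  have ha : thetaAuto C Zx Zy ^ 2 ≤ thetaMax C Zx Zy ^ 2 :=
    pow_le_pow_left₀ (thetaAuto_nonneg C Zx Zy) (le_max_left _ _) 2
  have hc : thetaCross C Zx Zy ^ 2 ≤ thetaMax C Zx Zy ^ 2 :=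
    pow_le_pow_left₀ (thetaCross_nonneg C Zx Zy) (le_max_right _ _) 2
  rw [div_le_iff₀ (by linarith)]
  nlinarith [mul_le_mul_of_nonneg_left hc (sub_nonneg.2 hK')]

/-! ### The weighted bound -/

/-- Squared inner products of the delayed members are bounded by the maximal ambiguity magnitudes,
except that the `(M N)²` of a vector with itself has to be added. -/
theorem norm_inner_delayed_sq_le (hC : IsUnimodular C) {Zx Zy m : ℕ} (hm : m ≤ Zx)
    (a b : Fin K × Fin m × Fin Zy) :
    ‖∑ p, delayed (C a.1) (N + m) a.2.1 a.2.2 p *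
        (starRingEnd ℂ) (delayed (C b.1) (N + m) b.2.1 b.2.2 p)‖ ^ 2 ≤
      (if a.1 = b.1 then thetaAuto C Zx Zy ^ 2 else thetaCross C Zx Zy ^ 2) +
        if a = b then ((M : ℝ) * N) ^ 2 else 0 := by
  obtain ⟨k, s, v⟩ := a
  obtain ⟨l, s', v'⟩ := b
  have hs := s.2
  have hs' := s'.2
  have hv := v.2
  have hv' := v'.2
  rw [inner_delayed _ _ (by simp only; omega), norm_mul, norm_omega_zpow, one_mul]
  simp only
  have hz : InZone Zx Zy ((s : ℕ) - (s' : ℕ)) ((v : ℕ) - (v' : ℕ)) := by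
    constructor <;> rw [abs_lt] <;> constructor <;> omega
  by_cases hkl : k = l
  · subst hkl
    rw [if_pos rfl]
    by_cases h : s = s' ∧ v = v'
    · obtain ⟨rfl, rfl⟩ := h
      rw [if_pos rfl, sub_self, sub_self, norm_compAF_self_zero (hC k)]
      nlinarith [sq_nonneg (thetaAuto C Zx Zy)]
    · rw [if_neg (by simpa using h), add_zero]
      refine pow_le_pow_left₀ (norm_nonneg _) (norm_compAF_le_thetaAuto hC k hz ?_) 2
      intro h0
      rw [Prod.mk.injEq] at h0
      exact h ⟨Fin.ext (by omega), Fin.ext (by omega)⟩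
  · rw [if_neg hkl, if_neg (by simp [hkl]), add_zero]
    exact pow_le_pow_left₀ (norm_nonneg _) (norm_compAF_le_thetaCross hC hkl hz) 2

/-- The number of positions covered by both of two windows of length `N` starting at `s` and `s'`.
-/
theorem sum_window_mul {N m s s' : ℕ} (hmN : m ≤ N) (hs : s < m) (hs' : s' < m) :
    ∑ t : Fin (N + m), (if s ≤ (t : ℕ) ∧ (t : ℕ) < s + N then (1 : ℝ) else 0) *
      (if s' ≤ (t : ℕ) ∧ (t : ℕ) < s' + N then 1 else 0) = N - |(s : ℝ) - s'| := by
  rw [Fin.sum_univ_eq_sum_range (fun t => (if s ≤ t ∧ t < s + N then (1 : ℝ) else 0) *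
      (if s' ≤ t ∧ t < s' + N then 1 else 0))]
  have h : ∀ t, (if s ≤ t ∧ t < s + N then (1 : ℝ) else 0) *
      (if s' ≤ t ∧ t < s' + N then 1 else 0) =
      if t ∈ Finset.Ico (max s s') (min s s' + N) then 1 else 0 := by
    intro t
    simp only [Finset.mem_Ico]
    split_ifs <;> first | (exfalso; omega) | norm_num
  simp only [h]
  rw [← Finset.sum_filter, Finset.filter_mem_eq_inter, Finset.inter_eq_right.2, Finset.sum_const,
    Nat.card_Ico, nsmul_eq_mul, mul_one]
  · rcases le_total s s' with hle | hle
    · have : (s : ℝ) ≤ s' := by exact_mod_cast hle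
      rw [max_eq_right hle, min_eq_left hle, abs_of_nonpos (by linarith), Nat.cast_sub (by omega)]
      push_cast
      ring
    · have : (s' : ℝ) ≤ s := by exact_mod_cast hle
      rw [max_eq_left hle, min_eq_right hle, abs_of_nonneg (by linarith), Nat.cast_sub (by omega)]
      push_cast
      ring
  · intro t
    rw [Finset.mem_Ico, Finset.mem_range]
    omega

/-- The diagonal of the weighted frame matrix of the delayed members. -/
theorem sum_frame_diag_sq (hC : IsUnimodular C) {m : ℕ} (hmN : m ≤ N) (Zy : ℕ) (w : ℕ → ℝ) :
    ∑ p, (∑ a : Fin K × Fin m × Fin Zy,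
        w a.2.1 * ‖delayed (C a.1) (N + m) a.2.1 a.2.2 p‖ ^ 2) ^ 2 =
      (K * Zy) ^ 2 * M *
        ∑ s : Fin m, ∑ s' : Fin m, w s * w s' * (N - |((s : ℕ) : ℝ) - (s' : ℕ)|) := by
  have h1 : ∀ (i : Fin M) (t : Fin (N + m)), (∑ k : Fin K, ∑ s : Fin m, ∑ v : Fin Zy,
        w s * ‖delayed (C k) (N + m) s v (i, t)‖ ^ 2) =
      K * Zy * ∑ s : Fin m, w s *
        if (s : ℕ) ≤ (t : ℕ) ∧ (t : ℕ) < s + N then (1 : ℝ) else 0 := by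
    intro i t
    simp only [norm_sq_delayed (hC _), Finset.sum_const, Finset.card_univ, Fintype.card_fin,
      nsmul_eq_mul]
    simp only [← Finset.mul_sum]
    ring
  simp only [Fintype.sum_prod_type]
  simp only [h1, mul_pow, Finset.sum_const, Finset.card_univ, Fintype.card_fin, nsmul_eq_mul]
  simp only [← Finset.mul_sum]
  rw [show ∀ S T : ℝ, S = T → (M : ℝ) * ((K : ℝ) ^ 2 * (Zy : ℝ) ^ 2 * S) =
    (K : ℝ) ^ 2 * (Zy : ℝ) ^ 2 * M * T from fun S T h => by rw [h]; ring]
  simp only [sq, Finset.sum_mul_sum]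
  rw [Finset.sum_comm]
  refine Finset.sum_congr rfl fun s _ => ?_
  rw [Finset.sum_comm]
  refine Finset.sum_congr rfl fun s' _ => ?_
  rw [← sum_window_mul hmN s.2 s'.2, Finset.mul_sum]
  refine Finset.sum_congr rfl fun t _ => ?_
  ring

theorem sum_sum_ite_eq_const (K : ℕ) (x y : ℝ) :
    ∑ k : Fin K, ∑ l : Fin K, (if k = l then x else y) = K * (x + (K - 1) * y) := by
  have h : ∀ k l : Fin K, (if k = l then x else y) = y + if k = l then x - y else 0 := by
    intro k l
    split_ifs <;> ring
  simp only [h, Finset.sum_add_distrib, Finset.sum_ite_eq, Finset.mem_univ, if_true,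
    Finset.sum_const, Finset.card_univ, Fintype.card_fin, nsmul_eq_mul]
  ring

/-- Summing the entrywise bounds of `norm_inner_delayed_sq_le` against the weights. -/
theorem sum_upper {Zy m : ℕ} (w : ℕ → ℝ) (hsum : ∑ s : Fin m, w s = 1) (F : Fin K → Fin K → ℝ)
    (z : ℝ) :
    ∑ a : Fin K × Fin m × Fin Zy, ∑ b : Fin K × Fin m × Fin Zy,
        w a.2.1 * w b.2.1 * (F a.1 b.1 + if a = b then z else 0) =
      Zy ^ 2 * ∑ k, ∑ l, F k l + K * Zy * z * ∑ s : Fin m, w s ^ 2 := by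
  simp only [mul_add (_ * _), Finset.sum_add_distrib]
  congr 1
  · simp only [Fintype.sum_prod_type, Finset.sum_const, Finset.card_univ, Fintype.card_fin,
      nsmul_eq_mul, mul_assoc]
    simp only [← Finset.mul_sum, ← Finset.sum_mul, hsum, one_mul]
    ring
  · simp only [mul_ite, mul_zero, Finset.sum_ite_eq, Finset.mem_univ, if_true,
      Fintype.sum_prod_type, Finset.sum_const, Finset.card_univ, Fintype.card_fin,
      nsmul_eq_mul, sq]
    simp only [← Finset.mul_sum, ← Finset.sum_mul]
    ring

/-- The Levenshtein-type bound for arbitrary nonnegative weights on the delays. -/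
theorem weighted_bound (hC : IsUnimodular C) (hK : 1 ≤ K) {Zx Zy m : ℕ} (hZy : 1 ≤ Zy)
    (hmx : m ≤ Zx) (hmN : m ≤ N) (w : ℕ → ℝ) (hw : ∀ s < m, 0 ≤ w s)
    (hsum : ∑ s : Fin m, w s = 1) :
    (M : ℝ) * (N - ∑ s : Fin m, ∑ s' : Fin m, w s * w s' * |((s : ℕ) : ℝ) - (s' : ℕ)| -
        M * N ^ 2 / (K * Zy) * ∑ s : Fin m, w s ^ 2) ≤
      (((K : ℝ) - 1) * thetaCross C Zx Zy ^ 2 + thetaAuto C Zx Zy ^ 2) / K := by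
  have hK' : (0 : ℝ) < K := by exact_mod_cast hK
  have hZ' : (0 : ℝ) < Zy := by exact_mod_cast hZy
  have hlow := sum_diag_sq_le_sum_norm_inner_sq
    (fun a : Fin K × Fin m × Fin Zy => w a.2.1)
    (fun a => delayed (C a.1) (N + m) a.2.1 a.2.2)
  have hup : ∑ a : Fin K × Fin m × Fin Zy, ∑ b : Fin K × Fin m × Fin Zy,
      w a.2.1 * w b.2.1 * ‖∑ p, delayed (C a.1) (N + m) a.2.1 a.2.2 p *
        (starRingEnd ℂ) (delayed (C b.1) (N + m) b.2.1 b.2.2 p)‖ ^ 2 ≤ _ :=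
    Finset.sum_le_sum fun a _ => Finset.sum_le_sum fun b _ =>
      mul_le_mul_of_nonneg_left (norm_inner_delayed_sq_le hC hmx a b)
        (mul_nonneg (hw _ a.2.1.2) (hw _ b.2.1.2))
  rw [sum_upper w hsum
    (fun k l => if k = l then thetaAuto C Zx Zy ^ 2 else thetaCross C Zx Zy ^ 2),
    sum_sum_ite_eq_const] at hup
  have h := hlow.trans hup
  rw [sum_frame_diag_sq hC hmN] at h
  have hww : ∑ s : Fin m, ∑ s' : Fin m, w s * w s' * (N - |((s : ℕ) : ℝ) - (s' : ℕ)|) =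
      N - ∑ s : Fin m, ∑ s' : Fin m, w s * w s' * |((s : ℕ) : ℝ) - (s' : ℕ)| := by
    simp only [mul_sub, Finset.sum_sub_distrib, ← Finset.sum_mul, ← Finset.mul_sum, hsum, mul_one,
      one_mul]
  rw [hww] at h
  set Q := ∑ s : Fin m, ∑ s' : Fin m, w s * w s' * |((s : ℕ) : ℝ) - (s' : ℕ)|
  set W := ∑ s : Fin m, w s ^ 2
  rw [le_div_iff₀ hK']
  have e : (M : ℝ) * (N - Q - M * N ^ 2 / (K * Zy) * W) * K =
      ((K * Zy) ^ 2 * M * (N - Q) - K * Zy * (M * N) ^ 2 * W) / (K * Zy ^ 2) := by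
    field_simp
  rw [e, div_le_iff₀ (by positivity)]
  linarith

end Zone

/-! ### Cosine weights -/

/-- The unnormalized weights: a cosine arch centred at the middle of `{0, …, m - 1}`. -/
noncomputable def cosWeight (γ : ℝ) (m s : ℕ) : ℝ := Real.cos (γ * (s - (m - 1) / 2))

theorem sum_range_cosWeight (γ : ℝ) (m n : ℕ) :
    2 * Real.sin (γ / 2) * ∑ s ∈ range n, cosWeight γ m s =
      Real.sin (γ * (n - m / 2)) + Real.sin (m * γ / 2) := by
  induction n with
  | zero =>
    rw [Finset.sum_range_zero, mul_zero, ← sub_neg_eq_add, ← Real.sin_neg, eq_comm, sub_eq_zero]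
    congr 1
    push_cast
    ring
  | succ n ih =>
    rw [Finset.sum_range_succ, mul_add, ih, cosWeight]
    have e1 : γ * (((n + 1 : ℕ) : ℝ) - m / 2) = γ * (n - (m - 1) / 2) + γ / 2 := by
      push_cast
      ring
    have e2 : γ * ((n : ℝ) - m / 2) = γ * (n - (m - 1) / 2) - γ / 2 := by ring
    rw [e1, e2, Real.sin_add, Real.sin_sub]
    ring

theorem sin_half_mul_sum_cosWeight (γ : ℝ) (m : ℕ) :
    Real.sin (γ / 2) * ∑ s ∈ range m, cosWeight γ m s = Real.sin (m * γ / 2) := by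
  have h := sum_range_cosWeight γ m m
  rw [show γ * ((m : ℝ) - m / 2) = m * γ / 2 by ring] at h
  linarith

theorem one_sub_cos_eq (γ : ℝ) : 1 - Real.cos γ = 2 * Real.sin (γ / 2) ^ 2 := by
  have h := Real.cos_two_mul' (γ / 2)
  have h' := Real.sin_sq_add_cos_sq (γ / 2)
  rw [show 2 * (γ / 2) = γ by ring] at h
  linarith

/-- The stationarity equations for the quadratic form `a ∑ (w s)² + ∑ |s - s'| w s w s'`: the
discrete derivative in `s` of the expression vanishes. -/
theorem cosWeight_stationary {γ a : ℝ} (hsin : Real.sin (γ / 2) ≠ 0)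
    (ha : a * (1 - Real.cos γ) = 1) {m : ℕ} (s : ℕ) (hs : s < m) :
    a * cosWeight γ m s + ∑ t ∈ range m, |(s : ℝ) - t| * cosWeight γ m t =
      a * cosWeight γ m 0 + ∑ t ∈ range m, (t : ℝ) * cosWeight γ m t := by
  induction s with
  | zero => simp
  | succ s ih =>
    rw [← ih (by omega)]
    have hstep : ∑ t ∈ range m, |((s + 1 : ℕ) : ℝ) - t| * cosWeight γ m t -
        ∑ t ∈ range m, |(s : ℝ) - t| * cosWeight γ m t =
        2 * ∑ t ∈ range (s + 1), cosWeight γ m t - ∑ t ∈ range m, cosWeight γ m t := by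
      have hsub : ∑ t ∈ range (s + 1), cosWeight γ m t =
          ∑ t ∈ range m, if t < s + 1 then cosWeight γ m t else 0 := by
        rw [← Finset.sum_filter]
        refine Finset.sum_congr ?_ fun _ _ => rfl
        ext t
        simp only [Finset.mem_range, Finset.mem_filter]
        omega
      rw [hsub, Finset.mul_sum, ← Finset.sum_sub_distrib, ← Finset.sum_sub_distrib]
      refine Finset.sum_congr rfl fun t _ => ?_
      split_ifs with h
      · have : (t : ℝ) ≤ s := by exact_mod_cast Nat.lt_succ_iff.1 h
        push_cast
        rw [abs_of_nonneg (by linarith), abs_of_nonneg (by linarith)]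
        ring
      · have : (s : ℝ) + 1 ≤ t := by exact_mod_cast not_lt.1 h
        push_cast
        rw [abs_of_nonpos (by linarith), abs_of_nonpos (by linarith)]
        ring
    have hP := sum_range_cosWeight γ m (s + 1)
    have hT := sin_half_mul_sum_cosWeight γ m
    have hD : cosWeight γ m (s + 1) - cosWeight γ m s =
        -2 * Real.sin (γ / 2) * Real.sin (γ * ((s + 1 : ℕ) - m / 2)) := by
      have e1 : γ * (((s + 1 : ℕ) : ℝ) - (m - 1) / 2) = γ * ((s + 1 : ℕ) - m / 2) + γ / 2 := by
        ring
      have e2 : γ * ((s : ℝ) - (m - 1) / 2) = γ * ((s + 1 : ℕ) - m / 2) - γ / 2 := by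
        push_cast
        ring
      rw [cosWeight, cosWeight, e1, e2, Real.cos_add, Real.cos_sub]
      ring
    rw [one_sub_cos_eq] at ha
    have : a * (cosWeight γ m (s + 1) - cosWeight γ m s) +
        (2 * ∑ t ∈ range (s + 1), cosWeight γ m t - ∑ t ∈ range m, cosWeight γ m t) = 0 := by
      refine (mul_eq_zero.1 ?_).resolve_left hsin
      rw [hD]
      linear_combination hP - hT - Real.sin (γ * ((s + 1 : ℕ) - m / 2)) * ha
    linarith

theorem cosWeight_reflect (γ : ℝ) {m s : ℕ} (hs : s < m) :
    cosWeight γ m (m - 1 - s) = cosWeight γ m s := by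
  rw [cosWeight, cosWeight, ← Real.cos_neg, Nat.cast_sub (by omega), Nat.cast_sub (by omega)]
  congr 1
  push_cast
  ring

theorem sum_mul_cosWeight (γ : ℝ) (m : ℕ) :
    ∑ t ∈ range m, (t : ℝ) * cosWeight γ m t =
      ((m : ℝ) - 1) / 2 * ∑ t ∈ range m, cosWeight γ m t := by
  have h : ∑ t ∈ range m, (t : ℝ) * cosWeight γ m t =
      ∑ t ∈ range m, ((m : ℝ) - 1 - t) * cosWeight γ m t := by
    rw [← Finset.sum_range_reflect]
    refine Finset.sum_congr rfl fun t ht => ?_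
    have ht := Finset.mem_range.1 ht
    rw [cosWeight_reflect γ ht, Nat.cast_sub (by omega), Nat.cast_sub (by omega)]
    push_cast
    rfl
  have h2 : ∑ t ∈ range m, (t : ℝ) * cosWeight γ m t +
      ∑ t ∈ range m, ((m : ℝ) - 1 - t) * cosWeight γ m t =
      ((m : ℝ) - 1) * ∑ t ∈ range m, cosWeight γ m t := by
    rw [← Finset.sum_add_distrib, Finset.mul_sum]
    refine Finset.sum_congr rfl fun t _ => ?_
    ring
  linarith

/-- The value of the quadratic form at the normalized cosine weights. -/
theorem form_cosWeight {γ a : ℝ} (hsin : Real.sin (γ / 2) ≠ 0) (ha : a * (1 - Real.cos γ) = 1)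
    {m : ℕ} (hS : Real.sin (m * γ / 2) ≠ 0) (w : ℕ → ℝ)
    (hw : ∀ s, w s = Real.sin (γ / 2) / Real.sin (m * γ / 2) * cosWeight γ m s) :
    (∑ s ∈ range m, w s = 1) ∧
    ∑ s ∈ range m, ∑ s' ∈ range m, w s * w s' * |(s : ℝ) - s'| + a * ∑ s ∈ range m, w s ^ 2 =
      ((m : ℝ) - 1) / 2 + (Real.sin (m * γ / 2) - Real.sin ((m - 2) * γ / 2)) /
        (2 * (1 - Real.cos γ) * Real.sin (m * γ / 2)) := by
  have hT := sin_half_mul_sum_cosWeight γ m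
  have hsum : ∑ s ∈ range m, w s = 1 := by
    simp only [hw, ← Finset.mul_sum]
    rw [div_mul_eq_mul_div, hT, div_self hS]
  refine ⟨hsum, ?_⟩
  set B := Real.sin (γ / 2) / Real.sin (m * γ / 2) with hB
  have hc : 1 - Real.cos γ ≠ 0 := right_ne_zero_of_mul_eq_one ha
  have hstat : ∀ s ∈ range m, a * w s + ∑ t ∈ range m, |(s : ℝ) - t| * w t =
      a * w 0 + (m - 1) / 2 := by
    intro s hs
    have h := cosWeight_stationary hsin ha s (Finset.mem_range.1 hs)
    rw [sum_mul_cosWeight] at h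
    simp only [hw, mul_left_comm _ B, ← Finset.mul_sum] at hsum ⊢
    linear_combination B * h + ((m : ℝ) - 1) / 2 * hsum
  have h0 : a * w 0 = (Real.sin (m * γ / 2) - Real.sin ((m - 2) * γ / 2)) /
        (2 * (1 - Real.cos γ) * Real.sin (m * γ / 2)) := by
    have e1 : m * γ / 2 = (m - 1) * γ / 2 + γ / 2 := by ring
    have e2 : (m - 2) * γ / 2 = (m - 1) * γ / 2 - γ / 2 := by ring
    have e3 : cosWeight γ m 0 = Real.cos ((m - 1) * γ / 2) := by
      rw [cosWeight, ← Real.cos_neg]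
      congr 1
      push_cast
      ring
    have e4 : Real.sin (m * γ / 2) - Real.sin ((m - 2) * γ / 2) =
        2 * (Real.sin (γ / 2) * cosWeight γ m 0) := by
      rw [e3, e2, e1, Real.sin_add, Real.sin_sub]
      ring
    rw [e4, hw, hB, eq_div_iff (by positivity)]
    have e5 := div_mul_cancel₀ (Real.sin (γ / 2)) hS
    linear_combination (2 * a * (1 - Real.cos γ) * cosWeight γ m 0) * e5 +
      2 * Real.sin (γ / 2) * cosWeight γ m 0 * ha
  calc ∑ s ∈ range m, ∑ s' ∈ range m, w s * w s' * |(s : ℝ) - s'| + a * ∑ s ∈ range m, w s ^ 2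
      = ∑ s ∈ range m, w s * (a * w s + ∑ t ∈ range m, |(s : ℝ) - t| * w t) := by
        rw [Finset.mul_sum, ← Finset.sum_add_distrib]
        refine Finset.sum_congr rfl fun s _ => ?_
        rw [mul_add, Finset.mul_sum, add_comm]
        congr 1
        · ring
        · exact Finset.sum_congr rfl fun t _ => by ring
    _ = ∑ s ∈ range m, w s * (a * w 0 + (m - 1) / 2) :=
        Finset.sum_congr rfl fun s hs => by rw [hstat s hs]
    _ = _ := by rw [← Finset.sum_mul, hsum, one_mul, h0, add_comm]

theorem cosWeight_nonneg {γ : ℝ} (hγ : 0 < γ) {m s : ℕ} (hm : (m : ℝ) < Real.pi / γ + 1)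
    (hs : s < m) : 0 ≤ cosWeight γ m s := by
  have h1 : ((m : ℝ) - 1) * γ < Real.pi := by
    rw [← lt_div_iff₀ hγ]
    linarith
  have h2 : (s : ℝ) + 1 ≤ m := by exact_mod_cast hs
  have h3 : (0 : ℝ) ≤ s := Nat.cast_nonneg s
  apply Real.cos_nonneg_of_mem_Icc
  constructor <;> nlinarith

end DRCS

theorem mainTheorem9
    (K M N Zx Zy : ℕ) (hK : 1 ≤ K) (hM : 1 ≤ M)
    (hZx : 1 ≤ Zx) (hZxN : Zx ≤ N) (hZy : 1 ≤ Zy) (hZyN : Zy ≤ N)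
    (C : Fin K → Fin M → Fin N → ℂ) (hC : DRCS.IsUnimodular C)
    (hKZ : K * Zy ≤ M * N ^ 2)
    (γ : ℝ) (hγ : γ = Real.arccos (1 - ((K : ℝ) * (Zy : ℝ)) / ((M : ℝ) * (N : ℝ) ^ 2)))
    (m : ℕ) (hm1 : 1 ≤ m) (hm : (m : ℝ) < min ((Zx : ℝ) + 1) (Real.pi / γ + 1)) :
    (DRCS.thetaMax C Zx Zy) ^ 2 ≥
        (((K : ℝ) - 1) * (DRCS.thetaCross C Zx Zy) ^ 2 + (DRCS.thetaAuto C Zx Zy) ^ 2) / (K : ℝ) ∧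
      (((K : ℝ) - 1) * (DRCS.thetaCross C Zx Zy) ^ 2 + (DRCS.thetaAuto C Zx Zy) ^ 2) / (K : ℝ) ≥
        (M : ℝ) * ((N : ℝ) - ((m : ℝ) - 1) / 2 -
          (Real.sin ((m : ℝ) * γ / 2) - Real.sin (((m : ℝ) - 2) * γ / 2)) /
            (2 * (1 - Real.cos γ) * Real.sin ((m : ℝ) * γ / 2))) := by
  refine ⟨DRCS.average_le_thetaMax_sq hK C Zx Zy, ?_⟩
  have hmZ : m ≤ Zx := by
    have h : (m : ℝ) < ((Zx + 1 : ℕ) : ℝ) := by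
      push_cast
      exact hm.trans_le (min_le_left _ _)
    exact Nat.lt_succ_iff.1 (by exact_mod_cast h)
  have hmπ : (m : ℝ) < Real.pi / γ + 1 := hm.trans_le (min_le_right _ _)
  have hK' : (0 : ℝ) < K := by exact_mod_cast hK
  have hZ' : (0 : ℝ) < Zy := by exact_mod_cast hZy
  have hM' : (0 : ℝ) < M := by exact_mod_cast hM
  have hN' : (0 : ℝ) < N := by exact_mod_cast hZx.trans hZxN
  have hr0 : 0 < ((K : ℝ) * Zy) / (M * N ^ 2) := by positivity
  have hr1 : ((K : ℝ) * Zy) / (M * N ^ 2) ≤ 1 := by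
    rw [div_le_one (by positivity)]
    exact_mod_cast hKZ
  have hcos : Real.cos γ = 1 - ((K : ℝ) * Zy) / (M * N ^ 2) := by
    rw [hγ, Real.cos_arccos (by linarith) (by linarith)]
  have hγ0 : 0 < γ := by
    rw [hγ]
    exact Real.arccos_pos.2 (by linarith)
  have hγ2 : γ ≤ Real.pi / 2 := by
    rw [hγ]
    exact Real.arccos_le_pi_div_two.2 (by linarith)
  have ha : (M : ℝ) * N ^ 2 / (K * Zy) * (1 - Real.cos γ) = 1 := by
    rw [hcos]
    field_simp
    ring
  have hπ := Real.pi_pos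
  have hmγ : (m : ℝ) * γ < Real.pi + γ := by
    have := mul_lt_mul_of_pos_right hmπ hγ0
    rwa [add_mul, div_mul_cancel₀ _ hγ0.ne', one_mul] at this
  have hm' : (0 : ℝ) < m := by exact_mod_cast hm1
  have hsin : 0 < Real.sin (γ / 2) := Real.sin_pos_of_pos_of_lt_pi (by linarith) (by linarith)
  have hS : 0 < Real.sin (m * γ / 2) :=
    Real.sin_pos_of_pos_of_lt_pi (by positivity) (by linarith)
  obtain ⟨hsum, hform⟩ := DRCS.form_cosWeight hsin.ne' ha hS.ne'
    (fun s => Real.sin (γ / 2) / Real.sin (m * γ / 2) * DRCS.cosWeight γ m s) fun _ => rfl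
  set w : ℕ → ℝ := fun s => Real.sin (γ / 2) / Real.sin (m * γ / 2) * DRCS.cosWeight γ m s
  have hw : ∀ s < m, 0 ≤ w s := fun s hs =>
    mul_nonneg (div_pos hsin hS).le (DRCS.cosWeight_nonneg hγ0 hmπ hs)
  have hb := DRCS.weighted_bound hC hK hZy hmZ (hmZ.trans hZxN) w hw
    (by rw [Fin.sum_univ_eq_sum_range w]; exact hsum)
  have hQ : ∑ s : Fin m, ∑ s' : Fin m, w s * w s' * |((s : ℕ) : ℝ) - (s' : ℕ)| =
      ∑ s ∈ Finset.range m, ∑ s' ∈ Finset.range m, w s * w s' * |(s : ℝ) - s'| := by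
    rw [← Fin.sum_univ_eq_sum_range
      (fun s => ∑ s' ∈ Finset.range m, w s * w s' * |(s : ℝ) - s'|)]
    exact Finset.sum_congr rfl fun s _ =>
      Fin.sum_univ_eq_sum_range (fun s' => w s * w s' * |((s : ℕ) : ℝ) - s'|) m
  rw [hQ, Fin.sum_univ_eq_sum_range (fun s => w s ^ 2), sub_sub, hform, ← sub_sub] at hb
  exact hb
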